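/- For a probability measure $\eta$ on $\mathbb{R}$ write $F_\eta(x)=\eta((-\infty,x])$, $F_\eta(x-)=\eta((-\infty,x))$ and $F_\eta^{-1}(u)=\inf\{x\in\mathbb{R}:F_\eta(x)\ge u\}$. Let $\mathcal{P}_2(\mathbb{R})$ be the set of probability measures on $\mathbb{R}$ with finite second moment, $\Pi(\mu,\nu)$ the set of couplings of $\mu$ and $\nu$, $W_2^2(\mu,\nu)=\inf_{\pi\in\Pi(\mu,\nu)}\int|y-x|^2\,\pi(dx,dy)$, and $\Pi^{opt}(\mu,\nu)$ the set of couplings that attain this infimum. Write $\eta\le_{cx}\nu$ if $\int\phi\,d\eta\le\int\phi\,d\nu$ for every convex $\phi:\mathbb{R}\to\mathbb{R}$ for which both integrals make sense (infinite values allowed). A martingale coupling between $\eta$ and $\nu$ is a coupling of the form $\eta(dx)k(x,dy)$ with a Markov kernel $k$ such that $\int|y|\,k(x,dy)<\infty$ and $\int y\,k(x,dy)=x$ for all $x$. For $\mu,\nu\in\mathcal{P}_2(\mathbb{R})$ set $$\mathcal{I}_\mu^\nu=\Big\{\eta\in\mathcal{P}_2(\mathbb{R}):\eta\le_{cx}\nu,\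 W_2^2(\mu,\nu)=W_2^2(\mu,\eta)+\int|y|^2\nu(dy)-\int|z|^2\eta(dz)\Big\},$$ and let $\tilde{\mathcal{I}}_\mu^\nu$ be the set of the images of $\mu$ by the maps $x\mapsto\int y\,k(x,dy)$, where $k$ runs over the Markov kernels with $\mu(dx)k(x,dy)\in\Pi^{opt}(\mu,\nu)$. Proposition. Let $\mu,\nu\in\mathcal{P}_2(\mathbb{R})$ and $$\mathcal{T}(x)=\int_0^1F_\nu^{-1}\big(F_\mu(x-)+u[F_\mu(x)-F_\mu(x-)]\big)\,du,$$ an integral that converges for $\mu$-almost every $x$ and defines a $\mu$-a.e. measurable function. Then $\tilde{\mathcal{I}}_\mu^\nu=\{\mathcal{T}\#\mu\}$ and $\mathcal{I}_\mu^\nu=\{\eta\in\mathcal{P}_2(\mathbb{R}):\mathcal{T}\#\mu\le_{cx}\eta\le_{cx}\nu\}$. Moreover, $\Pi^{opt}(\mu,\mathcal{T}\#\mu)=\{(I_1,\mathcal{T})\#\mu\}$, where $I_1$ is the identity map of $\mathbb{R}$, and there is a unique martingale coupling between $\mathcal{T}\#\mu$ and $\nu$, and it is $W_2$-optimal. -/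

import Mathlib

open MeasureTheory ProbabilityTheory Set
open scoped ENNReal

/-- Probability measures with finite second moment. -/
structure IsP2 {E : Type*} [NormedAddCommGroup E] [MeasurableSpace E] (μ : Measure E) : Prop where
  isProb : IsProbabilityMeasure μ
  memLp : MemLp (fun x : E => x) 2 μ

/-- `Π(μ, ν)`: measures on `ℝ × ℝ` with first marginal `μ` and second marginal `ν`. -/
def couplings (μ ν : Measure ℝ) : Set (Measure (ℝ × ℝ)) :=
  {π | π.map Prod.fst = μ ∧ π.map Prod.snd = ν}

/-- The quadratic transport cost `∫ |y - x|² π(dx, dy)`, valued in `[0, ∞]`. -/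
noncomputable def quadCost (π : Measure (ℝ × ℝ)) : ℝ≥0∞ :=
  ∫⁻ p, ENNReal.ofReal (|p.2 - p.1| ^ 2) ∂π

/-- The squared Wasserstein distance `W₂²(μ, ν)`, valued in `[0, ∞]`. -/
noncomputable def W2sq (μ ν : Measure ℝ) : ℝ≥0∞ :=
  ⨅ π ∈ couplings μ ν, quadCost π

/-- `Π^opt(μ, ν)`: the set of `W₂`-optimal couplings. -/
def optCouplings (μ ν : Measure ℝ) : Set (Measure (ℝ × ℝ)) :=
  {π | IsP2 π ∧ π ∈ couplings μ ν ∧ W2sq μ ν = quadCost π}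

/-- The integral of `φ` makes sense: the positive or the negative part has a finite integral. -/
def IntegralMakesSense (φ : ℝ → ℝ) (μ : Measure ℝ) : Prop :=
  ∫⁻ x, ENNReal.ofReal (φ x) ∂μ ≠ ∞ ∨ ∫⁻ x, ENNReal.ofReal (-φ x) ∂μ ≠ ∞

/-- The integral of `φ` in `[-∞, ∞]`, as integral of the positive part minus integral of the
negative part. -/
noncomputable def extIntegral (φ : ℝ → ℝ) (μ : Measure ℝ) : EReal :=
  ((∫⁻ x, ENNReal.ofReal (φ x) ∂μ : ℝ≥0∞) : EReal) -
    ((∫⁻ x, ENNReal.ofReal (-φ x) ∂μ : ℝ≥0∞) : EReal)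

/-- The convex order: `∫ φ dη ≤ ∫ φ dν` for all convex `φ : ℝ → ℝ` such that both integrals make
sense (possibly with infinite values). -/
def ConvexOrderLE (η ν : Measure ℝ) : Prop :=
  ∀ φ : ℝ → ℝ, ConvexOn ℝ univ φ → IntegralMakesSense φ η → IntegralMakesSense φ ν →
    extIntegral φ η ≤ extIntegral φ ν

/-- Martingale Markov kernels: `∫ |y| k(x, dy) < ∞` and `∫ y k(x, dy) = x` for all `x`. -/
def IsMartingaleKernel (k : Kernel ℝ ℝ) : Prop :=
  IsMarkovKernel k ∧ ∀ x, Integrable (fun y : ℝ => y) (k x) ∧ ∫ y, y ∂(k x) = x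

/-- Martingale couplings between `η` and `ν`: the couplings of the form `η(dx) k(x, dy)` with `k` a
martingale Markov kernel. -/
def martingaleCouplings (η ν : Measure ℝ) : Set (Measure (ℝ × ℝ)) :=
  {π | π ∈ couplings η ν ∧ ∃ k : Kernel ℝ ℝ, IsMartingaleKernel k ∧ π = η ⊗ₘ k}

/-- The set `𝓘_μ^ν` of the `η ∈ 𝓟₂(ℝ)` with `η ≤_cx ν` and
`W₂²(μ, ν) = W₂²(μ, η) + ∫ y² dν - ∫ z² dη`. -/
def interSet (μ ν : Measure ℝ) : Set (Measure ℝ) :=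
  {η | IsP2 η ∧ ConvexOrderLE η ν ∧
    (W2sq μ ν).toReal = (W2sq μ η).toReal + ∫ y, |y| ^ 2 ∂ν - ∫ z, |z| ^ 2 ∂η}

/-- The set of barycentric images: the images of `μ` by `x ↦ ∫ y k(x, dy)`, where `k` is a Markov
kernel such that `μ(dx) k(x, dy)` is a `W₂`-optimal coupling between `μ` and `ν`. -/
def barySet (μ ν : Measure ℝ) : Set (Measure ℝ) :=
  {η | ∃ k : Kernel ℝ ℝ, IsMarkovKernel k ∧ μ ⊗ₘ k ∈ optCouplings μ ν ∧
    η = μ.map (fun x => ∫ y, y ∂(k x))}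

/-- The quantile function `F_ν⁻¹(u) = inf {x | F_ν(x) ≥ u}` (only meaningful for `0 < u < 1`). -/
noncomputable def quantile (ν : Measure ℝ) (u : ℝ) : ℝ :=
  sInf {x : ℝ | u ≤ cdf ν x}

/-- The function `u ↦ F_ν⁻¹(F_μ(x-) + u [F_μ(x) - F_μ(x-)])`. -/
noncomputable def jumpQuantile (μ ν : Measure ℝ) (x u : ℝ) : ℝ :=
  quantile ν
    (Function.leftLim (cdf μ) x + u * (cdf μ x - Function.leftLim (cdf μ) x))

/-- The map `𝓣(x) = ∫₀¹ F_ν⁻¹(F_μ(x-) + u [F_μ(x) - F_μ(x-)]) du`. -/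
noncomputable def baryMap (μ ν : Measure ℝ) (x : ℝ) : ℝ :=
  ∫ u in (0 : ℝ)..1, jumpQuantile μ ν x u

/-!
Let `k` be a Markov kernel that transports `μ` to some `η ≤_cx ν`, and let `b` be its barycenter
map. Since `𝓣 - b` has mean zero, the layer cake formula reads
`∫ x (𝓣(x) - b(x)) dμ = ∫ (∫_{(s, ∞)} (𝓣 - b) dμ) ds`. For `t = F_ν⁻¹(F_μ(s))`,
`∫_{(s, ∞)} (b - t) dμ ≤ ∫ (y - t)₊ dη ≤ ∫ (y - t)₊ dν`, and the comonotone coupling of `μ` and `ν`,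
whose barycenter map is `𝓣`, attains this bound because it splits at `(s, t)`. Hence the inner
integrals are nonnegative, and `𝓣` is the `μ`-a.e. unique maximizer of `∫ x b(x) dμ`.

For `η = ν` this gives optimality of the comonotone coupling. For general `η`, the identity between
the Wasserstein distances says that the optimal coupling of `μ` and `η` reaches the maximum, so that
`𝓣` is its barycenter map and `𝓣#μ ≤_cx η` by Jensen. Conversely, a coupling of `μ` and `ν` with
barycenter map `𝓣` attains every tail bound, so it is comonotone and therefore unique. Since `𝓣` is
nondecreasing, pushing the first coordinate by `𝓣` keeps the coupling comonotone and makes it a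
martingale coupling, and the same uniqueness applies to `𝓣#μ` and `ν`.
-/

section Quantile

open Filter Topology

lemma quantile_le_iff (ν : Measure ℝ) {u : ℝ} (hu : u ∈ Ioo (0 : ℝ) 1) (x : ℝ) :
    quantile ν u ≤ x ↔ u ≤ cdf ν x := by
  have hne : {x : ℝ | u ≤ cdf ν x}.Nonempty :=
    (((tendsto_cdf_atTop ν).eventually (lt_mem_nhds hu.2)).mono fun _ h => h.le).exists
  have hbdd : BddBelow {x : ℝ | u ≤ cdf ν x} := by
    obtain ⟨y, hy⟩ := ((tendsto_cdf_atBot ν).eventually (gt_mem_nhds hu.1)).exists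
    exact ⟨y, fun z hz => ((monotone_cdf ν).reflect_lt (hy.trans_le hz)).le⟩
  refine ⟨fun h => le_trans ?_ (monotone_cdf ν h), fun h => csInf_le hbdd h⟩
  have hright : Tendsto (cdf ν) (𝓝[>] quantile ν u) (𝓝 (cdf ν (quantile ν u))) :=
    ((cdf ν).right_continuous _).tendsto.mono_left (nhdsWithin_mono _ Ioi_subset_Ici_self)
  refine ge_of_tendsto hright ?_
  filter_upwards [self_mem_nhdsWithin] with y hy
  obtain ⟨z, hz, hzy⟩ := exists_lt_of_csInf_lt hne hy
  exact hz.trans (monotone_cdf ν hzy.le)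

lemma le_cdf_quantile (ν : Measure ℝ) {u : ℝ} (hu : u ∈ Ioo (0 : ℝ) 1) :
    u ≤ cdf ν (quantile ν u) :=
  (quantile_le_iff ν hu _).1 le_rfl

lemma monotoneOn_quantile (ν : Measure ℝ) : MonotoneOn (quantile ν) (Ioo 0 1) :=
  fun _ hu _ hv huv => (quantile_le_iff ν hu _).2 (huv.trans (le_cdf_quantile ν hv))

lemma quantile_of_nonpos (ν : Measure ℝ) {u : ℝ} (hu : u ≤ 0) : quantile ν u = 0 := by
  have huniv : {x : ℝ | u ≤ cdf ν x} = univ := eq_univ_of_forall fun x => hu.trans (cdf_nonneg ν x)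
  rw [quantile, huniv, Real.sInf_univ]

lemma quantile_of_one_lt (ν : Measure ℝ) {u : ℝ} (hu : 1 < u) : quantile ν u = 0 := by
  have hempty : {x : ℝ | u ≤ cdf ν x} = ∅ :=
    eq_empty_of_forall_notMem fun x hx => (hu.trans_le hx).not_ge (cdf_le_one ν x)
  rw [quantile, hempty, Real.sInf_empty]

lemma measurable_quantile (ν : Measure ℝ) : Measurable (quantile ν) := by
  have hmono : Monotone ((Ioo (0 : ℝ) 1).domRestrict (quantile ν)) :=
    fun u v huv => monotoneOn_quantile ν u.2 v.2 huv
  have hcompl : EqOn (quantile ν) (({1} : Set ℝ).indicator fun _ => quantile ν 1)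
      (Ioo (0 : ℝ) 1)ᶜ := by
    intro u hu
    rcases le_or_gt u 0 with h0 | h0
    · rw [quantile_of_nonpos ν h0, indicator_of_notMem (by simp; linarith)]
    rcases (not_lt.1 fun h1 => hu ⟨h0, h1⟩).eq_or_lt with rfl | h1
    · simp
    · rw [quantile_of_one_lt ν h1, indicator_of_notMem (by simpa using h1.ne')]
  refine measurable_of_restrict_of_restrict_compl measurableSet_Ioo hmono.measurable ?_
  rw [domRestrict_eq_domRestrict_iff.2 hcompl]
  exact (measurable_const.indicator (measurableSet_singleton 1)).comp measurable_subtype_coe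

end Quantile

section UniformUnit

open Filter Topology

/-- The uniform distribution on the unit interval. It is carried by the open interval, on which
`quantile` is not a junk value. -/
noncomputable def uniformUnit : Measure ℝ := volume.restrict (Ioo 0 1)

instance : IsProbabilityMeasure uniformUnit := ⟨by simp [uniformUnit]⟩

lemma ae_mem_uniformUnit : ∀ᵐ u ∂uniformUnit, u ∈ Ioo (0 : ℝ) 1 :=
  ae_restrict_mem measurableSet_Ioo

lemma uniformUnit_Iio {v : ℝ} (hv : v ≤ 1) : uniformUnit (Iio v) = ENNReal.ofReal v := by
  rw [uniformUnit, Measure.restrict_apply measurableSet_Iio, inter_comm, Ioo_inter_Iio,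
    min_eq_right hv, Real.volume_Ioo, sub_zero]

lemma eq_uniformUnit_of_Iio {P : Measure ℝ} [IsProbabilityMeasure P]
    (hP : ∀ v ∈ Ioo (0 : ℝ) 1, P (Iio v) = ENNReal.ofReal v) : P = uniformUnit := by
  have hcont := ENNReal.continuous_ofReal
  have apply_Iio (v : ℝ) : P (Iio v) = ENNReal.ofReal (min v 1) := by
    rcases le_or_gt v 0 with h0 | h0
    · rw [ENNReal.ofReal_of_nonpos ((min_le_left v 1).trans h0), ← ENNReal.ofReal_zero]
      refine le_antisymm (ge_of_tendsto (hcont.continuousWithinAt (s := Ioi 0)) ?_) (by simp)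
      filter_upwards [Ioo_mem_nhdsGT zero_lt_one] with w hw
      exact (measure_mono (Iio_subset_Iio (h0.trans hw.1.le))).trans (hP w hw).le
    rcases lt_or_ge v 1 with h1 | h1
    · rw [min_eq_left h1.le, hP v ⟨h0, h1⟩]
    · rw [min_eq_right h1]
      refine le_antisymm (by simpa using prob_le_one)
        (le_of_tendsto (hcont.continuousWithinAt (s := Iio 1)) ?_)
      filter_upwards [Ioo_mem_nhdsLT zero_lt_one] with w hw
      exact (hP w hw).ge.trans (measure_mono (Iio_subset_Iio (hw.2.le.trans h1)))
  have uniformUnit_apply_Iio (v : ℝ) : uniformUnit (Iio v) = ENNReal.ofReal (min v 1) := by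
    rw [← uniformUnit_Iio (min_le_right v 1)]
    simp only [uniformUnit, Measure.restrict_apply measurableSet_Iio, inter_comm _ (Ioo _ _),
      Ioo_inter_Iio]
    congr 2
    grind
  refine Measure.ext_of_Ici _ _ fun v => ?_
  simp_rw [← compl_Iio, prob_compl_eq_one_sub measurableSet_Iio, apply_Iio, uniformUnit_apply_Iio]

end UniformUnit

section JumpLevel

variable (μ : Measure ℝ)

/-- The point of the jump interval `[F_μ(x-), F_μ(x)]` with relative position `u`. -/
noncomputable def jumpLevel (x u : ℝ) : ℝ :=
  Function.leftLim (cdf μ) x + u * (cdf μ x - Function.leftLim (cdf μ) x)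

lemma measurable_jumpLevel : Measurable fun p : ℝ × ℝ => jumpLevel μ p.1 p.2 := by
  have hcdf : Measurable (cdf μ) := (monotone_cdf μ).measurable
  have hleft : Measurable (Function.leftLim (cdf μ)) := (monotone_cdf μ).leftLim.measurable
  unfold jumpLevel
  fun_prop

lemma measurable_jumpQuantile (ν : Measure ℝ) :
    Measurable fun p : ℝ × ℝ => jumpQuantile μ ν p.1 p.2 :=
  (measurable_quantile ν).comp (measurable_jumpLevel μ)

lemma jumpLevel_le_cdf {x s u : ℝ} (hu : u ∈ Ioo (0 : ℝ) 1) (hxs : x ≤ s) :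
    jumpLevel μ x u ≤ cdf μ s := by
  have hleft := (monotone_cdf μ).leftLim_le (le_refl x)
  have hmono := monotone_cdf μ hxs
  unfold jumpLevel
  nlinarith [hu.2]

lemma cdf_le_jumpLevel {x s u : ℝ} (hu : u ∈ Ioo (0 : ℝ) 1) (hsx : s < x) :
    cdf μ s ≤ jumpLevel μ x u := by
  have hleft := (monotone_cdf μ).leftLim_le (le_refl x)
  have hmono := (monotone_cdf μ).le_leftLim hsx
  unfold jumpLevel
  nlinarith [hu.1]

lemma ae_snd_mem_Ioo : ∀ᵐ p ∂(μ.prod uniformUnit), p.2 ∈ Ioo (0 : ℝ) 1 :=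
  Measure.quasiMeasurePreserving_snd.ae ae_mem_uniformUnit

lemma leftLim_cdf_quantile_le {v : ℝ} (hv : v ∈ Ioo (0 : ℝ) 1) :
    Function.leftLim (cdf μ) (quantile μ v) ≤ v := by
  refine le_of_tendsto ((monotone_cdf μ).tendsto_leftLim _) ?_
  filter_upwards [self_mem_nhdsWithin] with y hy
  exact (lt_of_not_ge fun h => not_le.2 hy ((quantile_le_iff μ hv y).2 h)).le

lemma jumpLevel_lt_ae_eq {v : ℝ} (hv : v ∈ Ioo (0 : ℝ) 1) :
    {p : ℝ × ℝ | jumpLevel μ p.1 p.2 < v} =ᵐ[μ.prod uniformUnit]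
      (Iio (quantile μ v) ×ˢ univ ∪
        {quantile μ v} ×ˢ {u | jumpLevel μ (quantile μ v) u < v} : Set (ℝ × ℝ)) := by
  filter_upwards [ae_snd_mem_Ioo μ] with ⟨x, u⟩ hu
  refine propext ?_
  change jumpLevel μ x u < v ↔ (x < quantile μ v ∧ True) ∨ (x = quantile μ v ∧ _ < v)
  rcases lt_trichotomy x (quantile μ v) with hx | rfl | hx
  · have hlt : cdf μ x < v := lt_of_not_ge fun h => hx.not_ge ((quantile_le_iff μ hv x).2 h)
    simp [hx, (jumpLevel_le_cdf μ hu le_rfl).trans_lt hlt]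
  · simp
  · simp [hx.not_gt, hx.ne', (le_cdf_quantile μ hv).trans (cdf_le_jumpLevel μ hu hx)]

variable [IsProbabilityMeasure μ]

lemma measure_Iio_eq_leftLim_cdf (x : ℝ) :
    μ (Iio x) = ENNReal.ofReal (Function.leftLim (cdf μ) x) := by
  conv_lhs => rw [← measure_cdf μ]
  rw [StieltjesFunction.measure_Iio _ (tendsto_cdf_atBot μ), sub_zero]

lemma measure_singleton_eq_jump (x : ℝ) :
    μ {x} = ENNReal.ofReal (cdf μ x - Function.leftLim (cdf μ) x) := by
  conv_lhs => rw [← measure_cdf μ]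
  rw [StieltjesFunction.measure_singleton]

lemma measure_jumpLevel_lt {v : ℝ} (hv : v ∈ Ioo (0 : ℝ) 1) :
    (μ.prod uniformUnit) {p | jumpLevel μ p.1 p.2 < v} = ENNReal.ofReal v := by
  set x := quantile μ v
  set a := Function.leftLim (cdf μ) x with ha
  set d := cdf μ x - a with hd
  have ha0 : 0 ≤ a := (cdf_nonneg μ (x - 1)).trans ((monotone_cdf μ).le_leftLim (by linarith))
  have hd0 : 0 ≤ d := sub_nonneg.2 ((monotone_cdf μ).leftLim_le le_rfl)
  have hav : a ≤ v := leftLim_cdf_quantile_le μ hv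
  have hvd : v ≤ a + d := by simpa [d] using le_cdf_quantile μ hv
  have hjump : ENNReal.ofReal d * uniformUnit {u | a + u * d < v} = ENNReal.ofReal (v - a) := by
    rcases hd0.eq_or_lt with h | h
    · rw [← h, ENNReal.ofReal_zero, zero_mul, ENNReal.ofReal_of_nonpos (by linarith)]
    · have hset : {u : ℝ | a + u * d < v} = Iio ((v - a) / d) := by
        ext u
        rw [mem_Iio, lt_div_iff₀ h, lt_sub_iff_add_lt', mem_ofPred_eq]
      rw [hset, uniformUnit_Iio ((div_le_one h).2 (by linarith)), ← ENNReal.ofReal_mul hd0,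
        mul_div_cancel₀ _ h.ne']
  have hdisj : Disjoint (Iio x ×ˢ (univ : Set ℝ)) ({x} ×ˢ {u | a + u * d < v}) :=
    disjoint_prod.2 (Or.inl (by simp))
  have hmeas : MeasurableSet {u : ℝ | a + u * d < v} := measurableSet_lt (by fun_prop) (by fun_prop)
  calc (μ.prod uniformUnit) {p | jumpLevel μ p.1 p.2 < v}
      = (μ.prod uniformUnit) (Iio x ×ˢ univ ∪ {x} ×ˢ {u | a + u * d < v}) :=
        measure_congr (jumpLevel_lt_ae_eq μ hv)
    _ = ENNReal.ofReal a + ENNReal.ofReal (v - a) := by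
        rw [measure_union hdisj ((measurableSet_singleton x).prod hmeas), Measure.prod_prod,
          Measure.prod_prod, measure_univ, mul_one, measure_Iio_eq_leftLim_cdf,
          measure_singleton_eq_jump, ← ha, ← hd, hjump]
    _ = ENNReal.ofReal v := by
        rw [← ENNReal.ofReal_add ha0 (sub_nonneg.2 hav), add_sub_cancel]

lemma map_jumpLevel : (μ.prod uniformUnit).map (fun p => jumpLevel μ p.1 p.2) = uniformUnit := by
  have hmeas := measurable_jumpLevel μ
  have := Measure.isProbabilityMeasure_map (μ := μ.prod uniformUnit) hmeas.aemeasurable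
  refine eq_uniformUnit_of_Iio fun v hv => ?_
  rw [Measure.map_apply hmeas measurableSet_Iio]
  exact measure_jumpLevel_lt μ hv

lemma ae_jumpLevel_mem_Ioo :
    ∀ᵐ p ∂(μ.prod uniformUnit), jumpLevel μ p.1 p.2 ∈ Ioo (0 : ℝ) 1 := by
  have h := ae_mem_uniformUnit
  rw [← map_jumpLevel μ] at h
  exact ae_of_ae_map (measurable_jumpLevel μ).aemeasurable h

lemma map_quantile_uniformUnit : uniformUnit.map (quantile μ) = μ := by
  refine Measure.ext_of_Iic _ _ fun x => ?_
  have hset : quantile μ ⁻¹' Iic x =ᵐ[uniformUnit] Iic (cdf μ x) := by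
    filter_upwards [ae_mem_uniformUnit] with u hu
    exact propext (quantile_le_iff μ hu x)
  have hIio : Iic (cdf μ x) =ᵐ[uniformUnit] Iio (cdf μ x) :=
    ae_restrict_of_ae Iio_ae_eq_Iic.symm
  rw [Measure.map_apply (measurable_quantile μ) measurableSet_Iic, measure_congr hset,
    measure_congr hIio, uniformUnit_Iio (cdf_le_one μ x), ofReal_cdf]

end JumpLevel

section Couplings

variable {μ ν : Measure ℝ} {π : Measure (ℝ × ℝ)}

lemma measurePreserving_fst_of_mem_couplings (hπ : π ∈ couplings μ ν) :
    MeasurePreserving Prod.fst π μ :=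
  ⟨measurable_fst, hπ.1⟩

lemma measurePreserving_snd_of_mem_couplings (hπ : π ∈ couplings μ ν) :
    MeasurePreserving Prod.snd π ν :=
  ⟨measurable_snd, hπ.2⟩

lemma isProbabilityMeasure_of_mem_couplings [IsProbabilityMeasure μ] (hπ : π ∈ couplings μ ν) :
    IsProbabilityMeasure π := by
  have : IsProbabilityMeasure (π.map Prod.fst) := by rwa [hπ.1]
  exact Measure.isProbabilityMeasure_of_map Prod.fst

lemma map_prodMk_mem_couplings {Ω : Type*} [MeasurableSpace Ω] {P : Measure Ω} {X Y : Ω → ℝ}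
    (hX : MeasurePreserving X P μ) (hY : MeasurePreserving Y P ν) :
    P.map (fun ω => (X ω, Y ω)) ∈ couplings μ ν :=
  ⟨(Measure.map_map measurable_fst (hX.measurable.prodMk hY.measurable)).trans hX.map_eq,
    (Measure.map_map measurable_snd (hX.measurable.prodMk hY.measurable)).trans hY.map_eq⟩

end Couplings

section Comonotone

/-- A measure on the plane is comonotone if two points drawn independently from it are almost
surely not in decreasing position. -/
def IsComonotone (π : Measure (ℝ × ℝ)) : Prop :=
  ∀ᵐ z ∂(π.prod π), z.1.1 < z.2.1 → z.1.2 ≤ z.2.2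

variable {μ ν : Measure ℝ} {π π' : Measure (ℝ × ℝ)}

lemma measurableSet_comonotone :
    MeasurableSet {z : (ℝ × ℝ) × (ℝ × ℝ) | z.1.1 < z.2.1 → z.1.2 ≤ z.2.2} :=
  (measurableSet_lt (by fun_prop) (by fun_prop)).imp (measurableSet_le (by fun_prop) (by fun_prop))

lemma isComonotone_map_iff {Ω : Type*} [MeasurableSpace Ω] {P : Measure Ω} [SFinite P]
    {X Y : Ω → ℝ} (hX : Measurable X) (hY : Measurable Y) :
    IsComonotone (P.map fun ω => (X ω, Y ω)) ↔
      ∀ᵐ z ∂(P.prod P), X z.1 < X z.2 → Y z.1 ≤ Y z.2 := by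
  have hXY := hX.prodMk hY
  rw [IsComonotone, Measure.map_prod_map P P hXY hXY,
    ae_map_iff (hXY.prodMap hXY).aemeasurable measurableSet_comonotone]
  rfl

lemma IsComonotone.measure_Iic_prod [SFinite π] (h : IsComonotone π) (hπ : π ∈ couplings μ ν)
    (s r : ℝ) : π (Iic s ×ˢ Iic r) = min (μ (Iic s)) (ν (Iic r)) := by
  have hnull : π.prod π ((Iic s ×ˢ Ioi r) ×ˢ (Ioi s ×ˢ Iic r)) = 0 := by
    refine measure_mono_null (fun z hz => ?_) h
    obtain ⟨⟨h11, h12⟩, h21, h22⟩ := hz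
    exact fun hz => ((hz (h11.trans_lt h21)).trans h22).not_gt h12
  have hfst : μ (Iic s) = π (Iic s ×ˢ Iic r) + π (Iic s ×ˢ Ioi r) := by
    rw [← hπ.1, Measure.map_apply measurable_fst measurableSet_Iic, ← prod_univ,
      ← measure_union (disjoint_prod.2 (Or.inr (Iic_disjoint_Ioi le_rfl)))
        (measurableSet_Iic.prod measurableSet_Ioi), ← prod_union, Iic_union_Ioi]
  have hsnd : ν (Iic r) = π (Iic s ×ˢ Iic r) + π (Ioi s ×ˢ Iic r) := by
    rw [← hπ.2, Measure.map_apply measurable_snd measurableSet_Iic, ← univ_prod,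
      ← measure_union (disjoint_prod.2 (Or.inl (Iic_disjoint_Ioi le_rfl)))
        (measurableSet_Ioi.prod measurableSet_Iic), ← union_prod, Iic_union_Ioi]
  rw [Measure.prod_prod, mul_eq_zero] at hnull
  rcases hnull with h0 | h0 <;> rw [hfst, hsnd, h0] <;> simp

lemma ext_of_Iic_prod [IsFiniteMeasure π] (huniv : π univ = π' univ)
    (h : ∀ s r, π (Iic s ×ˢ Iic r) = π' (Iic s ×ˢ Iic r)) : π = π' := by
  have hspan : IsCountablySpanning (range (Iic : ℝ → Set ℝ)) :=
    ⟨fun n : ℕ => Iic (n : ℝ), fun _ => mem_range_self _,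
      eq_univ_of_forall fun x => mem_iUnion.2 (exists_nat_ge x)⟩
  have hgen : (inferInstance : MeasurableSpace ℝ) = MeasurableSpace.generateFrom (range Iic) := by
    rw [← borel_eq_generateFrom_Iic]
    exact BorelSpace.measurable_eq
  have hprod := generateFrom_prod_eq hspan hspan
  rw [← hgen] at hprod
  refine ext_of_generate_finite _ hprod (isPiSystem_Iic.prod isPiSystem_Iic) ?_ huniv
  rintro _ ⟨_, ⟨s, rfl⟩, _, ⟨r, rfl⟩, rfl⟩
  exact h s r

lemma IsComonotone.eq [IsProbabilityMeasure μ] (h : IsComonotone π) (h' : IsComonotone π')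
    (hπ : π ∈ couplings μ ν) (hπ' : π' ∈ couplings μ ν) : π = π' := by
  have := isProbabilityMeasure_of_mem_couplings hπ
  have := isProbabilityMeasure_of_mem_couplings hπ'
  refine ext_of_Iic_prod (by simp) fun s r => ?_
  rw [h.measure_Iic_prod hπ, h'.measure_Iic_prod hπ']

/-- A measure on the plane splits at `(s, t)` if it is carried by the closed quadrants to the upper
right and to the lower left of this point. -/
def SplitsAt (π : Measure (ℝ × ℝ)) (s t : ℝ) : Prop :=
  ∀ᵐ p ∂π, (s < p.1 → t ≤ p.2) ∧ (p.1 ≤ s → p.2 ≤ t)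

lemma measurableSet_splitsAt (s t : ℝ) :
    MeasurableSet {p : ℝ × ℝ | (s < p.1 → t ≤ p.2) ∧ (p.1 ≤ s → p.2 ≤ t)} :=
  ((measurableSet_lt (by fun_prop) (by fun_prop)).imp
    (measurableSet_le (by fun_prop) (by fun_prop))).inter
  ((measurableSet_le (by fun_prop) (by fun_prop)).imp
    (measurableSet_le (by fun_prop) (by fun_prop)))

lemma isComonotone_of_splitsAt
    (h : ∀ s, π (Prod.fst ⁻¹' Iic s) ≠ 0 → π (Prod.fst ⁻¹' Ioi s) ≠ 0 → ∃ t, SplitsAt π s t) :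
    IsComonotone π := by
  have separated_by (s : ℝ) : ∀ᵐ z ∂(π.prod π), z.1.1 ≤ s → s < z.2.1 → z.1.2 ≤ z.2.2 := by
    by_cases hIic : π (Prod.fst ⁻¹' Iic s) = 0
    · filter_upwards [Measure.quasiMeasurePreserving_fst.ae (measure_eq_zero_iff_ae_notMem.1 hIic)]
        with z hz h1
      exact absurd h1 hz
    by_cases hIoi : π (Prod.fst ⁻¹' Ioi s) = 0
    · filter_upwards [Measure.quasiMeasurePreserving_snd.ae (measure_eq_zero_iff_ae_notMem.1 hIoi)]
        with z hz _ h2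
      exact absurd h2 hz
    obtain ⟨t, ht⟩ := h s hIic hIoi
    filter_upwards [Measure.quasiMeasurePreserving_fst.ae ht,
      Measure.quasiMeasurePreserving_snd.ae ht] with z hz1 hz2 h1 h2
    exact (hz1.2 h1).trans (hz2.1 h2)
  filter_upwards [ae_all_iff.2 fun q : ℚ => separated_by q] with z hz hlt
  obtain ⟨q, hq1, hq2⟩ := exists_rat_btwn hlt
  exact hz q hq1.le hq2

lemma IsComonotone.map_prodMap {T : ℝ → ℝ} {S : Set ℝ} [SFinite π] (h : IsComonotone π)
    (hT : Measurable T) (hTS : MonotoneOn T S) (hS : ∀ᵐ p ∂π, p.1 ∈ S) :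
    IsComonotone (π.map (Prod.map T id)) := by
  refine (isComonotone_map_iff (hT.comp measurable_fst) measurable_snd).2 ?_
  filter_upwards [h, Measure.quasiMeasurePreserving_fst.ae hS,
    Measure.quasiMeasurePreserving_snd.ae hS] with z hz h1 h2 hlt
  exact hz (hTS.reflect_lt h1 h2 hlt)

lemma isComonotone_map_graph {T : ℝ → ℝ} {S : Set ℝ} [SFinite μ] (hT : Measurable T)
    (hTS : MonotoneOn T S) (hS : ∀ᵐ x ∂μ, x ∈ S) : IsComonotone (μ.map fun x => (x, T x)) := by
  refine (isComonotone_map_iff measurable_id hT).2 ?_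
  filter_upwards [Measure.quasiMeasurePreserving_fst.ae hS,
    Measure.quasiMeasurePreserving_snd.ae hS] with z h1 h2 hlt
  exact hTS h1 h2 hlt.le

end Comonotone

section ComonotoneCoupling

variable (μ ν : Measure ℝ)

/-- The comonotone coupling of `μ` and `ν`: each atom of `μ` is spread over the quantiles of `ν`
at the levels which the atom occupies. -/
noncomputable def comonotoneCoupling : Measure (ℝ × ℝ) :=
  (μ.prod uniformUnit).map fun p => (p.1, jumpQuantile μ ν p.1 p.2)

/-- The kernel which disintegrates `comonotoneCoupling μ ν` with respect to `μ`. -/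
noncomputable def quantileKernel : Kernel ℝ ℝ :=
  (Kernel.id ×ₖ Kernel.const ℝ uniformUnit).map fun p => jumpQuantile μ ν p.1 p.2

instance : IsMarkovKernel (quantileKernel μ ν) :=
  Kernel.IsMarkovKernel.map _ (measurable_jumpQuantile μ ν)

lemma quantileKernel_apply (x : ℝ) :
    quantileKernel μ ν x = uniformUnit.map (jumpQuantile μ ν x) := by
  have hmeas := measurable_jumpQuantile μ ν
  rw [quantileKernel, Kernel.map_apply _ hmeas, Kernel.prod_apply, Kernel.id_apply,
    Kernel.const_apply, Measure.dirac_prod, Measure.map_map hmeas measurable_prodMk_left]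
  rfl

lemma measurable_jumpQuantile_right (x : ℝ) : Measurable (jumpQuantile μ ν x) :=
  Measurable.of_uncurry_left (f := jumpQuantile μ ν) (measurable_jumpQuantile μ ν)

variable [IsProbabilityMeasure μ]

lemma compProd_quantileKernel : μ ⊗ₘ quantileKernel μ ν = comonotoneCoupling μ ν := by
  have hmeas := measurable_fst.prodMk (measurable_jumpQuantile μ ν)
  ext s hs
  rw [Measure.compProd_apply hs, comonotoneCoupling, Measure.map_apply hmeas hs,
    Measure.prod_apply (hmeas hs)]
  refine lintegral_congr fun x => ?_
  rw [quantileKernel_apply, Measure.map_apply (measurable_jumpQuantile_right μ ν x)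
    (measurable_prodMk_left hs)]
  rfl

lemma isComonotone_comonotoneCoupling : IsComonotone (comonotoneCoupling μ ν) := by
  have hgood := (ae_snd_mem_Ioo μ).and (ae_jumpLevel_mem_Ioo μ)
  refine (isComonotone_map_iff measurable_fst (measurable_jumpQuantile μ ν)).2 ?_
  filter_upwards [Measure.quasiMeasurePreserving_fst.ae hgood,
    Measure.quasiMeasurePreserving_snd.ae hgood] with z ⟨hu1, hlevel1⟩ ⟨hu2, hlevel2⟩ hlt
  exact monotoneOn_quantile ν hlevel1 hlevel2
    ((jumpLevel_le_cdf μ hu1 le_rfl).trans (cdf_le_jumpLevel μ hu2 hlt))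

lemma splitsAt_comonotoneCoupling {s : ℝ} (hs : cdf μ s ∈ Ioo (0 : ℝ) 1) :
    SplitsAt (comonotoneCoupling μ ν) s (quantile ν (cdf μ s)) := by
  have hmeas := measurable_fst.prodMk (measurable_jumpQuantile μ ν)
  refine (ae_map_iff hmeas.aemeasurable (measurableSet_splitsAt s _)).2 ?_
  filter_upwards [ae_snd_mem_Ioo μ, ae_jumpLevel_mem_Ioo μ] with p hu hlevel
  exact ⟨fun h => monotoneOn_quantile ν hs hlevel (cdf_le_jumpLevel μ hu h),
    fun h => monotoneOn_quantile ν hlevel hs (jumpLevel_le_cdf μ hu h)⟩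

variable [IsProbabilityMeasure ν]

lemma comonotoneCoupling_mem_couplings : comonotoneCoupling μ ν ∈ couplings μ ν := by
  have hlevel : MeasurePreserving (fun p : ℝ × ℝ => jumpLevel μ p.1 p.2)
      (μ.prod uniformUnit) uniformUnit := ⟨measurable_jumpLevel μ, map_jumpLevel μ⟩
  have hquantile : MeasurePreserving (quantile ν) uniformUnit ν :=
    ⟨measurable_quantile ν, map_quantile_uniformUnit ν⟩
  exact map_prodMk_mem_couplings measurePreserving_fst (hquantile.comp hlevel)

end ComonotoneCoupling

section ConvexOrder

variable {η ν : Measure ℝ} {φ : ℝ → ℝ}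

lemma continuous_of_convexOn_univ (hφ : ConvexOn ℝ univ φ) : Continuous φ :=
  continuousOn_univ.1 (hφ.continuousOn isOpen_univ)

lemma exists_affine_le_of_convexOn_univ (hφ : ConvexOn ℝ univ φ) :
    ∃ a c : ℝ, ∀ x, a * x + c ≤ φ x := by
  obtain ⟨a, c, h⟩ := hφ.exists_affine_le_real isClosed_univ
    (continuous_of_convexOn_univ hφ).continuousOn.lowerSemicontinuousOn
  exact ⟨a, c, fun x => h x (mem_univ x)⟩

lemma extIntegral_eq_integral (h : Integrable φ ν) :
    extIntegral φ ν = ((∫ x, φ x ∂ν : ℝ) : EReal) := by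
  have hneg : ∫⁻ x, ENNReal.ofReal (-φ x) ∂ν ≠ ∞ := h.neg.lintegral_lt_top.ne
  rw [integral_eq_lintegral_pos_part_sub_lintegral_neg_part h, extIntegral, EReal.coe_sub,
    EReal.coe_ennreal_toReal h.lintegral_lt_top.ne, EReal.coe_ennreal_toReal hneg]

lemma extIntegral_eq_top_of_not_integrable [IsFiniteMeasure ν] (hν : Integrable (fun x => x) ν)
    (hφ : ConvexOn ℝ univ φ) (hnot : ¬ Integrable φ ν) : extIntegral φ ν = ⊤ := by
  have hcont := continuous_of_convexOn_univ hφ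
  obtain ⟨a, c, hac⟩ := exists_affine_le_of_convexOn_univ hφ
  have haff : Integrable (fun x => a * x + c) ν := (hν.const_mul a).add (integrable_const c)
  have hneg : ∫⁻ x, ENNReal.ofReal (-φ x) ∂ν ≠ ∞ :=
    ne_top_of_le_ne_top haff.neg.lintegral_lt_top.ne
      (lintegral_mono fun x => ENNReal.ofReal_le_ofReal (neg_le_neg (hac x)))
  have hpos : ∫⁻ x, ENNReal.ofReal (φ x) ∂ν = ∞ := by
    by_contra hfin
    refine hnot (integrable_of_le_of_le hcont.aestronglyMeasurable (ae_of_all ν hac)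
      (ae_of_all ν fun x => ?_) haff
      (integrable_toReal_of_lintegral_ne_top hcont.measurable.ennreal_ofReal.aemeasurable hfin))
    exact (le_max_left _ _).trans_eq (ENNReal.toReal_ofReal').symm
  rw [extIntegral, hpos, EReal.coe_ennreal_top, EReal.top_sub]
  exact fun h => hneg (EReal.coe_ennreal_eq_top_iff.1 h)

lemma convexOrderLE_refl (ν : Measure ℝ) : ConvexOrderLE ν ν := fun _ _ _ _ => le_rfl

lemma ConvexOrderLE.integral_le (h : ConvexOrderLE η ν) (hφ : ConvexOn ℝ univ φ)
    (hη : Integrable φ η) (hν : Integrable φ ν) : ∫ x, φ x ∂η ≤ ∫ x, φ x ∂ν := by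
  have hle := h φ hφ (Or.inl hη.lintegral_lt_top.ne) (Or.inl hν.lintegral_lt_top.ne)
  rwa [extIntegral_eq_integral hη, extIntegral_eq_integral hν, EReal.coe_le_coe_iff] at hle

lemma convexOrderLE_of_integral_le [IsFiniteMeasure ν] (hν : Integrable (fun x => x) ν)
    (h : ∀ φ : ℝ → ℝ, ConvexOn ℝ univ φ → Integrable φ ν →
      Integrable φ η ∧ ∫ x, φ x ∂η ≤ ∫ x, φ x ∂ν) : ConvexOrderLE η ν := by
  intro φ hφ _ _
  by_cases hφν : Integrable φ ν
  · obtain ⟨hφη, hle⟩ := h φ hφ hφν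
    rw [extIntegral_eq_integral hφν, extIntegral_eq_integral hφη]
    exact EReal.coe_le_coe_iff.2 hle
  · rw [extIntegral_eq_top_of_not_integrable hν hφ hφν]
    exact le_top

lemma ConvexOrderLE.integral_id_eq (h : ConvexOrderLE η ν) (hη : Integrable (fun x => x) η)
    (hν : Integrable (fun x => x) ν) : ∫ x, x ∂η = ∫ x, x ∂ν := by
  refine le_antisymm (h.integral_le (convexOn_id convex_univ) hη hν) ?_
  have hneg := h.integral_le (φ := fun x => -x) (concaveOn_id convex_univ).neg hη.neg hν.neg
  rwa [integral_neg, integral_neg, neg_le_neg_iff] at hneg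

lemma ConvexOrderLE.integral_posPart_le [IsFiniteMeasure η] [IsFiniteMeasure ν]
    (h : ConvexOrderLE η ν) (hη : Integrable (fun x => x) η) (hν : Integrable (fun x => x) ν)
    (t : ℝ) : ∫ y, max (y - t) 0 ∂η ≤ ∫ y, max (y - t) 0 ∂ν :=
  h.integral_le (((convexOn_id convex_univ).sub (concaveOn_const t convex_univ)).sup
    (convexOn_const 0 convex_univ)) (hη.sub (integrable_const t)).pos_part
    (hν.sub (integrable_const t)).pos_part

end ConvexOrder

section Barycenter

/-- The function which maps `x` to the barycenter of `k x`, with the junk value `0` where `k x` has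
no first moment. -/
noncomputable def barycenter {α : Type*} [MeasurableSpace α] (k : Kernel α ℝ) (x : α) : ℝ :=
  ∫ y, y ∂(k x)

variable {α : Type*} [MeasurableSpace α] {μ : Measure α} {ν : Measure ℝ} {k : Kernel α ℝ}

lemma measurable_barycenter (k : Kernel α ℝ) : Measurable (barycenter k) :=
  (StronglyMeasurable.integral_kernel (f := fun y : ℝ => y)
    measurable_id'.stronglyMeasurable).measurable

lemma integrable_integral_comp {f : ℝ → ℝ} (hf : Integrable f (k ∘ₘ μ)) :
    Integrable (fun x => ∫ y, f y ∂(k x)) μ := by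
  rw [Measure.comp_eq_comp_const_apply] at hf
  simpa using hf.integral_comp

lemma integral_integral_comp {f : ℝ → ℝ} (hf : Integrable f (k ∘ₘ μ)) :
    ∫ x, ∫ y, f y ∂(k x) ∂μ = ∫ y, f y ∂(k ∘ₘ μ) := by
  rw [Measure.comp_eq_comp_const_apply] at hf ⊢
  simpa using (Kernel.integral_comp hf).symm

lemma integrable_barycenter (hk : k ∘ₘ μ = ν) (hν : Integrable (fun y => y) ν) :
    Integrable (barycenter k) μ :=
  integrable_integral_comp (hk ▸ hν)

lemma integral_barycenter (hk : k ∘ₘ μ = ν) (hν : Integrable (fun y => y) ν) :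
    ∫ x, barycenter k x ∂μ = ∫ y, y ∂ν := by
  subst hk
  exact integral_integral_comp hν

lemma ae_map_barycenter_le [IsMarkovKernel k] (hk : k ∘ₘ μ = ν) (hν : Integrable (fun y => y) ν)
    {φ : ℝ → ℝ} (hφ : ConvexOn ℝ univ φ) (hφν : Integrable φ ν) :
    ∀ᵐ x ∂μ, φ (barycenter k x) ≤ ∫ y, φ y ∂(k x) := by
  subst hk
  filter_upwards [Measure.ae_integrable_of_integrable_comp hν,
    Measure.ae_integrable_of_integrable_comp hφν] with x hx hφx
  exact hφ.map_integral_le (continuous_of_convexOn_univ hφ).continuousOn isClosed_univ (by simp)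
    hx hφx

lemma integrable_map_barycenter [IsFiniteMeasure μ] [IsMarkovKernel k] (hk : k ∘ₘ μ = ν)
    (hν : Integrable (fun y => y) ν) {φ : ℝ → ℝ} (hφ : ConvexOn ℝ univ φ)
    (hφν : Integrable φ ν) : Integrable (fun x => φ (barycenter k x)) μ := by
  obtain ⟨a, c, hac⟩ := exists_affine_le_of_convexOn_univ hφ
  exact integrable_of_le_of_le
    ((continuous_of_convexOn_univ hφ).measurable.comp
      (measurable_barycenter k)).aestronglyMeasurable
    (ae_of_all μ fun x => hac _) (ae_map_barycenter_le hk hν hφ hφν)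
    (((integrable_barycenter hk hν).const_mul a).add (integrable_const c))
    (integrable_integral_comp (hk ▸ hφν))

lemma integral_map_barycenter_le [IsFiniteMeasure μ] [IsMarkovKernel k] (hk : k ∘ₘ μ = ν)
    (hν : Integrable (fun y => y) ν) {φ : ℝ → ℝ} (hφ : ConvexOn ℝ univ φ)
    (hφν : Integrable φ ν) : ∫ x, φ (barycenter k x) ∂μ ≤ ∫ y, φ y ∂ν := by
  have hint := integrable_map_barycenter hk hν hφ hφν
  have hle := ae_map_barycenter_le hk hν hφ hφν
  subst hk
  exact (integral_mono_ae hint (integrable_integral_comp hφν) hle).trans_eq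
    (integral_integral_comp hφν)

lemma convexOrderLE_map_barycenter [IsFiniteMeasure μ] [IsMarkovKernel k] (hk : k ∘ₘ μ = ν)
    (hν : Integrable (fun y => y) ν) : ConvexOrderLE (μ.map (barycenter k)) ν := by
  have : IsFiniteMeasure ν := hk ▸ inferInstance
  have hmeas := (measurable_barycenter k).aemeasurable (μ := μ)
  refine convexOrderLE_of_integral_le hν fun φ hφ hφν => ?_
  have hcont := (continuous_of_convexOn_univ hφ).aestronglyMeasurable (μ := μ.map (barycenter k))
  rw [integrable_map_measure hcont hmeas, integral_map hmeas hcont]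
  exact ⟨integrable_map_barycenter hk hν hφ hφν, integral_map_barycenter_le hk hν hφ hφν⟩

end Barycenter

section TailInequality

variable {α : Type*} [MeasurableSpace α] {μ : Measure α} {f : α → ℝ} {A : Set α}

lemma setIntegral_le_integral_posPart (hf : Integrable f μ) :
    ∫ x in A, f x ∂μ ≤ ∫ x, max (f x) 0 ∂μ :=
  (integral_mono hf.integrableOn hf.pos_part.integrableOn fun _ => le_max_left _ _).trans
    (setIntegral_le_integral hf.pos_part (ae_of_all μ fun _ => le_max_right _ _))

lemma setIntegral_eq_integral_posPart_iff (hf : Integrable f μ) (hA : MeasurableSet A) :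
    ∫ x in A, f x ∂μ = ∫ x, max (f x) 0 ∂μ ↔
      ∀ᵐ x ∂μ, (x ∈ A → 0 ≤ f x) ∧ (x ∉ A → f x ≤ 0) := by
  have hle : A.indicator f ≤ᵐ[μ] fun x => max (f x) 0 := by
    refine ae_of_all μ fun x => ?_
    by_cases hx : x ∈ A <;> simp [hx]
  rw [← integral_indicator hA, integral_eq_iff_of_ae_le (hf.indicator hA) hf.pos_part hle]
  refine Filter.eventually_congr (ae_of_all μ fun x => ?_)
  by_cases hx : x ∈ A <;> simp [hx]

variable {k : Kernel α ℝ} [IsMarkovKernel k] [IsFiniteMeasure μ] {ν : Measure ℝ}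

lemma integrable_snd_sub_compProd (hk : k ∘ₘ μ = ν) (hν : Integrable (fun y => y) ν) (t : ℝ) :
    Integrable (fun p : α × ℝ => p.2 - t) (μ ⊗ₘ k) := by
  subst hk
  exact ((Measure.integrable_compProd_snd_iff hν.aestronglyMeasurable).2 hν).sub
    (integrable_const t)

lemma setIntegral_barycenter_sub_const (hk : k ∘ₘ μ = ν) (hν : Integrable (fun y => y) ν)
    (hA : MeasurableSet A) (t : ℝ) :
    ∫ x in A, (barycenter k x - t) ∂μ = ∫ p in Prod.fst ⁻¹' A, (p.2 - t) ∂(μ ⊗ₘ k) := by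
  have hint := integrable_snd_sub_compProd hk hν t
  subst hk
  rw [← prod_univ, Measure.setIntegral_compProd hA MeasurableSet.univ hint.integrableOn]
  refine integral_congr_ae (ae_restrict_of_ae ?_)
  filter_upwards [Measure.ae_integrable_of_integrable_comp hν] with x hx
  rw [setIntegral_univ, integral_sub hx (integrable_const t), integral_const, probReal_univ,
    one_smul, barycenter]

lemma setIntegral_barycenter (hk : k ∘ₘ μ = ν) (hν : Integrable (fun y => y) ν)
    (hA : MeasurableSet A) :
    ∫ x in A, barycenter k x ∂μ = ∫ p in Prod.fst ⁻¹' A, p.2 ∂(μ ⊗ₘ k) := by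
  simpa only [sub_zero] using setIntegral_barycenter_sub_const hk hν hA 0

lemma integral_posPart_snd_compProd (hk : k ∘ₘ μ = ν) (t : ℝ) :
    ∫ p, max (p.2 - t) 0 ∂(μ ⊗ₘ k) = ∫ y, max (y - t) 0 ∂ν := by
  rw [← hk, ← Measure.snd_compProd, Measure.snd, integral_map (by fun_prop) (by fun_prop)]

lemma setIntegral_barycenter_sub_le (hk : k ∘ₘ μ = ν) (hν : Integrable (fun y => y) ν)
    (hA : MeasurableSet A) (t : ℝ) :
    ∫ x in A, (barycenter k x - t) ∂μ ≤ ∫ y, max (y - t) 0 ∂ν := by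
  rw [setIntegral_barycenter_sub_const hk hν hA, ← integral_posPart_snd_compProd hk]
  exact setIntegral_le_integral_posPart (integrable_snd_sub_compProd hk hν t)

end TailInequality

section TailReal

variable {μ η ν : Measure ℝ} {k : Kernel ℝ ℝ} [IsMarkovKernel k]

lemma setIntegral_Ioi_barycenter_sub_eq_iff [IsFiniteMeasure μ] (hk : k ∘ₘ μ = ν)
    (hν : Integrable (fun y => y) ν) (s t : ℝ) :
    ∫ x in Ioi s, (barycenter k x - t) ∂μ = ∫ y, max (y - t) 0 ∂ν ↔ SplitsAt (μ ⊗ₘ k) s t := by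
  rw [setIntegral_barycenter_sub_const hk hν measurableSet_Ioi, ← integral_posPart_snd_compProd hk,
    setIntegral_eq_integral_posPart_iff (integrable_snd_sub_compProd hk hν t)
      (measurable_fst measurableSet_Ioi)]
  simp only [SplitsAt, mem_preimage, mem_Ioi, not_lt, sub_nonneg, sub_nonpos]

lemma compProd_mem_couplings_iff [SFinite μ] : μ ⊗ₘ k ∈ couplings μ ν ↔ k ∘ₘ μ = ν := by
  rw [← Measure.snd_compProd μ k]
  exact and_iff_right (Measure.fst_compProd μ k)

lemma baryMap_eq_barycenter (μ ν : Measure ℝ) : baryMap μ ν = barycenter (quantileKernel μ ν) := by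
  ext x
  rw [barycenter, quantileKernel_apply, integral_map
    (measurable_jumpQuantile_right μ ν x).aemeasurable measurable_id'.aestronglyMeasurable, baryMap,
    intervalIntegral.integral_of_le zero_le_one, integral_Ioc_eq_integral_Ioo, uniformUnit]

lemma measurable_baryMap (μ ν : Measure ℝ) : Measurable (baryMap μ ν) :=
  baryMap_eq_barycenter μ ν ▸ measurable_barycenter _

variable [IsProbabilityMeasure μ]

lemma cdf_mem_Ioo {s : ℝ} (hIic : μ (Iic s) ≠ 0) (hIoi : μ (Ioi s) ≠ 0) :
    cdf μ s ∈ Ioo (0 : ℝ) 1 := by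
  rw [← compl_Iic, Ne, prob_compl_eq_zero_iff measurableSet_Iic, ← ofReal_cdf μ,
    ENNReal.ofReal_eq_one] at hIoi
  rw [← ofReal_cdf μ, Ne, ENNReal.ofReal_eq_zero, not_le] at hIic
  exact ⟨hIic, (cdf_le_one μ s).lt_of_ne hIoi⟩

variable [IsProbabilityMeasure ν]

lemma comp_quantileKernel (μ ν : Measure ℝ) [IsProbabilityMeasure μ] [IsProbabilityMeasure ν] :
    quantileKernel μ ν ∘ₘ μ = ν := by
  rw [← compProd_mem_couplings_iff, compProd_quantileKernel]
  exact comonotoneCoupling_mem_couplings μ ν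

lemma integrable_baryMap (hν : Integrable (fun y => y) ν) : Integrable (baryMap μ ν) μ :=
  baryMap_eq_barycenter μ ν ▸ integrable_barycenter (comp_quantileKernel μ ν) hν

lemma integral_baryMap (hν : Integrable (fun y => y) ν) : ∫ x, baryMap μ ν x ∂μ = ∫ y, y ∂ν :=
  baryMap_eq_barycenter μ ν ▸ integral_barycenter (comp_quantileKernel μ ν) hν

lemma convexOrderLE_map_baryMap (hν : Integrable (fun y => y) ν) :
    ConvexOrderLE (μ.map (baryMap μ ν)) ν :=
  baryMap_eq_barycenter μ ν ▸ convexOrderLE_map_barycenter (comp_quantileKernel μ ν) hν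

lemma ae_integrable_jumpQuantile (hν : Integrable (fun y => y) ν) :
    ∀ᵐ x ∂μ, Integrable (jumpQuantile μ ν x) uniformUnit := by
  filter_upwards [Measure.ae_integrable_of_integrable_comp
    ((comp_quantileKernel μ ν).symm ▸ hν)] with x hx
  rw [quantileKernel_apply] at hx
  exact hx.comp_measurable (measurable_jumpQuantile_right μ ν x)

lemma exists_monotoneOn_baryMap (hν : Integrable (fun y => y) ν) :
    ∃ S, (∀ᵐ x ∂μ, x ∈ S) ∧ MonotoneOn (baryMap μ ν) S := by
  refine ⟨{x | Integrable (jumpQuantile μ ν x) uniformUnit ∧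
    ∀ᵐ u ∂uniformUnit, jumpLevel μ x u ∈ Ioo (0 : ℝ) 1},
    (ae_integrable_jumpQuantile hν).and (Measure.ae_ae_of_ae_prod (ae_jumpLevel_mem_Ioo μ)), ?_⟩
  rintro x ⟨hx, hlevel⟩ x' ⟨hx', hlevel'⟩ hle
  obtain rfl | hlt := hle.eq_or_lt
  · exact le_rfl
  rw [baryMap, baryMap, intervalIntegral.integral_of_le zero_le_one,
    intervalIntegral.integral_of_le zero_le_one, integral_Ioc_eq_integral_Ioo,
    integral_Ioc_eq_integral_Ioo]
  refine integral_mono_ae hx hx' ?_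
  filter_upwards [ae_mem_uniformUnit, hlevel, hlevel'] with u hu hu1 hu2
  exact monotoneOn_quantile ν hu1 hu2
    ((jumpLevel_le_cdf μ hu le_rfl).trans (cdf_le_jumpLevel μ hu hlt))

lemma setIntegral_Ioi_baryMap_sub_quantile (hν : Integrable (fun y => y) ν) {s : ℝ}
    (hs : cdf μ s ∈ Ioo (0 : ℝ) 1) :
    ∫ x in Ioi s, (baryMap μ ν x - quantile ν (cdf μ s)) ∂μ =
      ∫ y, max (y - quantile ν (cdf μ s)) 0 ∂ν := by
  rw [baryMap_eq_barycenter, setIntegral_Ioi_barycenter_sub_eq_iff (comp_quantileKernel μ ν) hν,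
    compProd_quantileKernel]
  exact splitsAt_comonotoneCoupling μ ν hs

lemma setIntegral_Ioi_barycenter_le_baryMap [IsProbabilityMeasure η] (hcx : ConvexOrderLE η ν)
    (hk : k ∘ₘ μ = η) (hη : Integrable (fun y => y) η) (hν : Integrable (fun y => y) ν) (s : ℝ) :
    ∫ x in Ioi s, barycenter k x ∂μ ≤ ∫ x in Ioi s, baryMap μ ν x ∂μ := by
  by_cases hIoi : μ (Ioi s) = 0
  · simp [setIntegral_measure_zero _ hIoi]
  by_cases hIic : μ (Iic s) = 0
  · have huniv : Ioi s =ᵐ[μ] univ := by rwa [ae_eq_univ, compl_Ioi]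
    simp_rw [setIntegral_congr_set huniv, setIntegral_univ]
    rw [integral_barycenter hk hη, integral_baryMap hν, hcx.integral_id_eq hη hν]
  set t := quantile ν (cdf μ s)
  have hle : ∫ x in Ioi s, (barycenter k x - t) ∂μ ≤ ∫ x in Ioi s, (baryMap μ ν x - t) ∂μ :=
    calc ∫ x in Ioi s, (barycenter k x - t) ∂μ
        ≤ ∫ y, max (y - t) 0 ∂η := setIntegral_barycenter_sub_le hk hη measurableSet_Ioi t
      _ ≤ ∫ y, max (y - t) 0 ∂ν := hcx.integral_posPart_le hη hν t
      _ = ∫ x in Ioi s, (baryMap μ ν x - t) ∂μ :=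
          (setIntegral_Ioi_baryMap_sub_quantile hν (cdf_mem_Ioo hIic hIoi)).symm
  rwa [integral_sub (integrable_barycenter hk hη).integrableOn (integrable_const t),
    integral_sub (integrable_baryMap hν).integrableOn (integrable_const t),
    sub_le_sub_iff_right] at hle

lemma compProd_eq_comonotoneCoupling (hk : k ∘ₘ μ = ν) (hν : Integrable (fun y => y) ν)
    (hbary : barycenter k =ᵐ[μ] baryMap μ ν) : μ ⊗ₘ k = comonotoneCoupling μ ν := by
  have hmem := compProd_mem_couplings_iff.2 hk
  have hfst := measurePreserving_fst_of_mem_couplings hmem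
  refine IsComonotone.eq (isComonotone_of_splitsAt fun s hIic hIoi => ?_)
    (isComonotone_comonotoneCoupling μ ν) hmem (comonotoneCoupling_mem_couplings μ ν)
  rw [hfst.measure_preimage measurableSet_Iic.nullMeasurableSet] at hIic
  rw [hfst.measure_preimage measurableSet_Ioi.nullMeasurableSet] at hIoi
  refine ⟨quantile ν (cdf μ s), (setIntegral_Ioi_barycenter_sub_eq_iff hk hν s _).1 ?_⟩
  rw [← setIntegral_Ioi_baryMap_sub_quantile hν (cdf_mem_Ioo hIic hIoi)]
  refine integral_congr_ae (ae_restrict_of_ae ?_)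
  filter_upwards [hbary] with x hx
  rw [hx]

end TailReal

section LayerCake

/-- The kernel `1_{s < x} - 1_{s < 0}` of the signed layer cake formula: its integral over `s` is
`x`. -/
noncomputable def layerKernel (x s : ℝ) : ℝ :=
  (Ico 0 x).indicator 1 s - (Ico x 0).indicator 1 s

lemma layerKernel_eq_indicator_Ioi (x s : ℝ) :
    layerKernel x s = (Ioi s).indicator 1 x - (Iio 0).indicator 1 s := by
  simp only [layerKernel, indicator, mem_Ico, mem_Ioi, mem_Iio, Pi.one_apply]
  grind

lemma abs_layerKernel (x s : ℝ) :
    |layerKernel x s| = (Ico 0 x).indicator 1 s + (Ico x 0).indicator 1 s := by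
  simp only [layerKernel, indicator, mem_Ico, Pi.one_apply]
  grind

lemma measurable_layerKernel : Measurable fun p : ℝ × ℝ => layerKernel p.1 p.2 := by
  simp only [layerKernel_eq_indicator_Ioi]
  refine Measurable.sub ?_ ((measurable_one.indicator measurableSet_Iio).comp measurable_snd)
  exact measurable_one.indicator (measurableSet_lt measurable_snd measurable_fst)

lemma integrable_indicator_Ico_one (a b : ℝ) :
    Integrable ((Ico a b).indicator (1 : ℝ → ℝ)) :=
  (integrableOn_const (C := (1 : ℝ)) (by simp)).integrable_indicator measurableSet_Ico

lemma integrable_layerKernel (x : ℝ) : Integrable (layerKernel x) :=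
  (integrable_indicator_Ico_one 0 x).sub (integrable_indicator_Ico_one x 0)

lemma integral_layerKernel (x : ℝ) : ∫ s, layerKernel x s = x := by
  simp only [layerKernel]
  rw [integral_sub (integrable_indicator_Ico_one 0 x) (integrable_indicator_Ico_one x 0),
    integral_indicator_one measurableSet_Ico, integral_indicator_one measurableSet_Ico,
    Real.volume_real_Ico, Real.volume_real_Ico]
  grind

lemma integral_abs_layerKernel (x : ℝ) : ∫ s, |layerKernel x s| = |x| := by
  simp only [abs_layerKernel]
  rw [integral_add (integrable_indicator_Ico_one 0 x) (integrable_indicator_Ico_one x 0),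
    integral_indicator_one measurableSet_Ico, integral_indicator_one measurableSet_Ico,
    Real.volume_real_Ico, Real.volume_real_Ico]
  grind

variable {μ : Measure ℝ} {h : ℝ → ℝ}

lemma integral_layerKernel_mul (hh : Integrable h μ) (h0 : ∫ x, h x ∂μ = 0) (s : ℝ) :
    ∫ x, layerKernel x s * h x ∂μ = ∫ x in Ioi s, h x ∂μ := by
  have hsplit (x : ℝ) : layerKernel x s * h x =
      (Ioi s).indicator h x - (Iio 0).indicator 1 s * h x := by
    rw [layerKernel_eq_indicator_Ioi, sub_mul, ← indicator_mul_left]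
    simp only [Pi.one_apply, one_mul]
  simp_rw [hsplit]
  rw [integral_sub (hh.indicator measurableSet_Ioi) (hh.const_mul _),
    integral_indicator measurableSet_Ioi, integral_const_mul, h0, mul_zero, sub_zero]

lemma tendsto_setIntegral_Ioi (hh : Integrable h μ) {s : ℝ} {u : ℕ → ℝ} (hu : Antitone u)
    (hs : ∀ n, s < u n) (hlim : Filter.Tendsto u Filter.atTop (nhds s)) :
    Filter.Tendsto (fun n => ∫ x in Ioi (u n), h x ∂μ) Filter.atTop
      (nhds (∫ x in Ioi s, h x ∂μ)) := by
  have hUnion : ⋃ n, Ioi (u n) = Ioi s := by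
    ext x
    simp only [mem_iUnion, mem_Ioi]
    exact ⟨fun ⟨n, hn⟩ => (hs n).trans hn, fun hx => (hlim.eventually_lt_const hx).exists⟩
  rw [← hUnion]
  exact tendsto_setIntegral_of_monotone (fun n => measurableSet_Ioi)
    (fun m n hmn => Ioi_subset_Ioi (hu hmn)) hh.integrableOn

lemma ae_eq_zero_of_setIntegral_Ioi_eq_zero (hh : Integrable h μ) (h0 : ∫ x, h x ∂μ = 0)
    (hIoi : ∀ s, ∫ x in Ioi s, h x ∂μ = 0) : h =ᵐ[μ] 0 := by
  suffices hset : ∀ A, MeasurableSet A → ∫ x in A, h x ∂μ = 0 from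
    hh.ae_eq_zero_of_forall_setIntegral_eq_zero fun A hA _ => hset A hA
  intro A hA
  have hgen : borel ℝ = MeasurableSpace.generateFrom (range Ioi) := borel_eq_generateFrom_Ioi ℝ
  rw [← BorelSpace.measurable_eq (α := ℝ)] at hgen
  induction A, hA using MeasurableSpace.induction_on_inter hgen isPiSystem_Ioi with
  | empty => exact setIntegral_empty
  | basic _ hB =>
    obtain ⟨s, rfl⟩ := hB
    exact hIoi s
  | compl B hB ih => rw [setIntegral_compl hB hh, h0, ih, sub_zero]
  | iUnion B hdisj hB ih =>
    simp only [integral_iUnion hB hdisj hh.integrableOn, ih, tsum_zero]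

lemma integrable_layerKernel_mul (hh : Integrable h μ) (hxh : Integrable (fun x => x * h x) μ) :
    Integrable (Function.uncurry fun x s => layerKernel x s * h x) (μ.prod volume) := by
  have hmeas : AEStronglyMeasurable (Function.uncurry fun x s => layerKernel x s * h x)
      (μ.prod volume) :=
    measurable_layerKernel.aestronglyMeasurable.mul hh.aestronglyMeasurable.comp_fst
  refine (integrable_prod_iff hmeas).2 ⟨?_, ?_⟩
  · exact ae_of_all μ fun x => (integrable_layerKernel x).mul_const (h x)
  · refine hxh.norm.congr (ae_of_all μ fun x => ?_)
    simp only [Function.uncurry_apply_pair, norm_mul, Real.norm_eq_abs]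
    rw [integral_mul_const, integral_abs_layerKernel]

variable [SFinite μ]

lemma integrable_setIntegral_Ioi (hh : Integrable h μ) (hxh : Integrable (fun x => x * h x) μ)
    (h0 : ∫ x, h x ∂μ = 0) : Integrable fun s => ∫ x in Ioi s, h x ∂μ :=
  (integrable_layerKernel_mul hh hxh).integral_prod_right.congr
    (ae_of_all volume (integral_layerKernel_mul hh h0))

lemma integral_id_mul_eq_integral_setIntegral_Ioi (hh : Integrable h μ)
    (hxh : Integrable (fun x => x * h x) μ) (h0 : ∫ x, h x ∂μ = 0) :
    ∫ x, x * h x ∂μ = ∫ s, ∫ x in Ioi s, h x ∂μ := by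
  calc ∫ x, x * h x ∂μ = ∫ x, (∫ s, layerKernel x s * h x) ∂μ := by
        simp only [integral_mul_const, integral_layerKernel]
    _ = ∫ s, ∫ x, layerKernel x s * h x ∂μ :=
        integral_integral_swap (integrable_layerKernel_mul hh hxh)
    _ = ∫ s, ∫ x in Ioi s, h x ∂μ := by simp only [integral_layerKernel_mul hh h0]

lemma integral_id_mul_nonneg (hh : Integrable h μ) (hxh : Integrable (fun x => x * h x) μ)
    (h0 : ∫ x, h x ∂μ = 0) (hpos : ∀ s, 0 ≤ ∫ x in Ioi s, h x ∂μ) : 0 ≤ ∫ x, x * h x ∂μ := by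
  rw [integral_id_mul_eq_integral_setIntegral_Ioi hh hxh h0]
  exact integral_nonneg hpos

lemma ae_eq_zero_of_integral_id_mul_eq_zero (hh : Integrable h μ)
    (hxh : Integrable (fun x => x * h x) μ) (h0 : ∫ x, h x ∂μ = 0)
    (hpos : ∀ s, 0 ≤ ∫ x in Ioi s, h x ∂μ) (hzero : ∫ x, x * h x ∂μ = 0) : h =ᵐ[μ] 0 := by
  rw [integral_id_mul_eq_integral_setIntegral_Ioi hh hxh h0,
    integral_eq_zero_iff_of_nonneg hpos (integrable_setIntegral_Ioi hh hxh h0)] at hzero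
  refine ae_eq_zero_of_setIntegral_Ioi_eq_zero hh h0 fun s => ?_
  obtain ⟨u, hu, hus, hlim⟩ := (Measure.dense_of_ae hzero).exists_seq_strictAnti_tendsto s
  exact tendsto_nhds_unique (tendsto_setIntegral_Ioi hh hu.antitone (fun n => (hus n).1) hlim)
    (tendsto_const_nhds.congr fun n => (hus n).2.symm)

end LayerCake

section SecondMoment

variable {μ η ν : Measure ℝ} {π : Measure (ℝ × ℝ)}

lemma IsP2.integrable_id (hμ : IsP2 μ) : Integrable (fun x => x) μ :=
  have := hμ.isProb
  hμ.memLp.integrable one_le_two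

lemma memLp_fst_of_mem_couplings (hπ : π ∈ couplings μ ν) (hμ : IsP2 μ) :
    MemLp (fun p => p.1) 2 π :=
  hμ.memLp.comp_measurePreserving (measurePreserving_fst_of_mem_couplings hπ)

lemma memLp_snd_of_mem_couplings (hπ : π ∈ couplings μ ν) (hν : IsP2 ν) :
    MemLp (fun p => p.2) 2 π :=
  hν.memLp.comp_measurePreserving (measurePreserving_snd_of_mem_couplings hπ)

lemma isP2_of_mem_couplings (hπ : π ∈ couplings μ ν) (hμ : IsP2 μ) (hν : IsP2 ν) : IsP2 π :=
  have := hμ.isProb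
  ⟨isProbabilityMeasure_of_mem_couplings hπ,
    MemLp.of_fst_snd ⟨memLp_fst_of_mem_couplings hπ hμ, memLp_snd_of_mem_couplings hπ hν⟩⟩

lemma integrable_mul_of_mem_couplings (hπ : π ∈ couplings μ ν) (hμ : IsP2 μ) (hν : IsP2 ν) :
    Integrable (fun p => p.1 * p.2) π :=
  (memLp_fst_of_mem_couplings hπ hμ).integrable_mul (memLp_snd_of_mem_couplings hπ hν)

lemma integral_abs_sub_sq_of_mem_couplings (hπ : π ∈ couplings μ ν) (hμ : IsP2 μ) (hν : IsP2 ν) :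
    ∫ p, |p.2 - p.1| ^ 2 ∂π =
      ∫ x, x ^ 2 ∂μ + ∫ y, y ^ 2 ∂ν - 2 * ∫ p, p.1 * p.2 ∂π := by
  have hfst := (memLp_fst_of_mem_couplings hπ hμ).integrable_sq
  have hsnd := (memLp_snd_of_mem_couplings hπ hν).integrable_sq
  have hadd : Integrable (fun p => p.1 ^ 2 + p.2 ^ 2) π := hfst.add hsnd
  have hmul := integrable_mul_of_mem_couplings hπ hμ hν
  have hexpand (p : ℝ × ℝ) : |p.2 - p.1| ^ 2 = p.1 ^ 2 + p.2 ^ 2 - 2 * (p.1 * p.2) := by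
    rw [sq_abs]
    ring
  simp_rw [hexpand]
  rw [integral_sub hadd (hmul.const_mul 2), integral_add hfst hsnd, integral_const_mul,
    ← hπ.1, ← hπ.2, integral_map (by fun_prop) (by fun_prop),
    integral_map (by fun_prop) (by fun_prop)]

lemma quadCost_ne_top (hπ : π ∈ couplings μ ν) (hμ : IsP2 μ) (hν : IsP2 ν) : quadCost π ≠ ∞ := by
  have hsub := (memLp_snd_of_mem_couplings hπ hν).sub (memLp_fst_of_mem_couplings hπ hμ)
  exact hsub.norm.integrable_sq.lintegral_lt_top.ne

lemma toReal_quadCost (hπ : π ∈ couplings μ ν) (hμ : IsP2 μ) (hν : IsP2 ν) :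
    (quadCost π).toReal =
      ∫ x, x ^ 2 ∂μ + ∫ y, y ^ 2 ∂ν - 2 * ∫ p, p.1 * p.2 ∂π := by
  rw [← integral_abs_sub_sq_of_mem_couplings hπ hμ hν,
    integral_eq_lintegral_of_nonneg_ae (ae_of_all π fun p => by positivity) (by fun_prop), quadCost]

lemma quadCost_le_quadCost_iff {π' : Measure (ℝ × ℝ)} (hπ : π ∈ couplings μ ν)
    (hπ' : π' ∈ couplings μ ν) (hμ : IsP2 μ) (hν : IsP2 ν) :
    quadCost π ≤ quadCost π' ↔ ∫ p, p.1 * p.2 ∂π' ≤ ∫ p, p.1 * p.2 ∂π := by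
  rw [← ENNReal.toReal_le_toReal (quadCost_ne_top hπ hμ hν) (quadCost_ne_top hπ' hμ hν),
    toReal_quadCost hπ hμ hν, toReal_quadCost hπ' hμ hν, sub_le_sub_iff_left,
    mul_le_mul_iff_right₀ two_pos]

variable {k : Kernel ℝ ℝ} [IsMarkovKernel k]

lemma memLp_barycenter [IsFiniteMeasure μ] (hk : k ∘ₘ μ = η) (hη : IsP2 η) :
    MemLp (barycenter k) 2 μ :=
  (memLp_two_iff_integrable_sq (measurable_barycenter k).aestronglyMeasurable).2
    (integrable_map_barycenter hk hη.integrable_id even_two.convexOn_pow hη.memLp.integrable_sq)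

lemma integrable_id_mul_barycenter (hk : k ∘ₘ μ = η) (hμ : IsP2 μ) (hη : IsP2 η) :
    Integrable (fun x => x * barycenter k x) μ :=
  have := hμ.isProb
  hμ.memLp.integrable_mul (memLp_barycenter hk hη)

lemma integral_mul_compProd (hk : k ∘ₘ μ = η) (hμ : IsP2 μ) (hη : IsP2 η) :
    ∫ p, p.1 * p.2 ∂(μ ⊗ₘ k) = ∫ x, x * barycenter k x ∂μ := by
  have := hμ.isProb
  rw [Measure.integral_compProd
    (integrable_mul_of_mem_couplings (compProd_mem_couplings_iff.2 hk) hμ hη)]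
  exact integral_congr_ae (ae_of_all μ fun x => integral_const_mul x _)

lemma isP2_map_baryMap (hμ : IsP2 μ) (hν : IsP2 ν) : IsP2 (μ.map (baryMap μ ν)) := by
  have := hμ.isProb
  have := hν.isProb
  have hmeas := (measurable_baryMap μ ν).aemeasurable (μ := μ)
  refine ⟨Measure.isProbabilityMeasure_map hmeas, ?_⟩
  rw [memLp_map_measure_iff (by fun_prop) hmeas, baryMap_eq_barycenter]
  exact memLp_barycenter (comp_quantileKernel μ ν) hν

end SecondMoment

section BarycenterComparison

variable {μ η ν : Measure ℝ} {k : Kernel ℝ ℝ}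

lemma integrable_id_mul_baryMap (hμ : IsP2 μ) (hν : IsP2 ν) :
    Integrable (fun x => x * baryMap μ ν x) μ :=
  have := hμ.isProb
  have := hν.isProb
  baryMap_eq_barycenter μ ν ▸ integrable_id_mul_barycenter (comp_quantileKernel μ ν) hμ hν

lemma integrable_baryMap_sub_barycenter (hk : k ∘ₘ μ = η) (hμ : IsP2 μ) (hη : IsP2 η)
    (hν : IsP2 ν) : Integrable (fun x => baryMap μ ν x - barycenter k x) μ :=
  have := hμ.isProb
  have := hν.isProb
  (integrable_baryMap hν.integrable_id).sub (integrable_barycenter hk hη.integrable_id)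

lemma integral_baryMap_sub_barycenter (hcx : ConvexOrderLE η ν) (hk : k ∘ₘ μ = η) (hμ : IsP2 μ)
    (hη : IsP2 η) (hν : IsP2 ν) : ∫ x, (baryMap μ ν x - barycenter k x) ∂μ = 0 := by
  have := hμ.isProb
  have := hν.isProb
  rw [integral_sub (integrable_baryMap hν.integrable_id)
    (integrable_barycenter hk hη.integrable_id), integral_baryMap hν.integrable_id,
    integral_barycenter hk hη.integrable_id, hcx.integral_id_eq hη.integrable_id hν.integrable_id,
    sub_self]

variable [IsMarkovKernel k]

lemma integrable_id_mul_baryMap_sub_barycenter (hk : k ∘ₘ μ = η) (hμ : IsP2 μ) (hη : IsP2 η)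
    (hν : IsP2 ν) : Integrable (fun x => x * (baryMap μ ν x - barycenter k x)) μ := by
  simp_rw [mul_sub]
  exact (integrable_id_mul_baryMap hμ hν).sub (integrable_id_mul_barycenter hk hμ hη)

lemma integral_id_mul_baryMap_sub_barycenter (hk : k ∘ₘ μ = η) (hμ : IsP2 μ) (hη : IsP2 η)
    (hν : IsP2 ν) :
    ∫ x, x * (baryMap μ ν x - barycenter k x) ∂μ =
      ∫ x, x * baryMap μ ν x ∂μ - ∫ x, x * barycenter k x ∂μ := by
  simp_rw [mul_sub]
  exact integral_sub (integrable_id_mul_baryMap hμ hν) (integrable_id_mul_barycenter hk hμ hη)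

lemma setIntegral_Ioi_baryMap_sub_barycenter_nonneg (hcx : ConvexOrderLE η ν) (hk : k ∘ₘ μ = η)
    (hμ : IsP2 μ) (hη : IsP2 η) (hν : IsP2 ν) (s : ℝ) :
    0 ≤ ∫ x in Ioi s, (baryMap μ ν x - barycenter k x) ∂μ := by
  have := hμ.isProb
  have := hη.isProb
  have := hν.isProb
  rw [integral_sub (integrable_baryMap hν.integrable_id).integrableOn
    (integrable_barycenter hk hη.integrable_id).integrableOn, sub_nonneg]
  exact setIntegral_Ioi_barycenter_le_baryMap hcx hk hη.integrable_id hν.integrable_id s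

lemma integral_id_mul_barycenter_le (hcx : ConvexOrderLE η ν) (hk : k ∘ₘ μ = η) (hμ : IsP2 μ)
    (hη : IsP2 η) (hν : IsP2 ν) :
    ∫ x, x * barycenter k x ∂μ ≤ ∫ x, x * baryMap μ ν x ∂μ := by
  have := hμ.isProb
  rw [← sub_nonneg, ← integral_id_mul_baryMap_sub_barycenter hk hμ hη hν]
  exact integral_id_mul_nonneg (integrable_baryMap_sub_barycenter hk hμ hη hν)
    (integrable_id_mul_baryMap_sub_barycenter hk hμ hη hν)
    (integral_baryMap_sub_barycenter hcx hk hμ hη hν)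
    (setIntegral_Ioi_baryMap_sub_barycenter_nonneg hcx hk hμ hη hν)

lemma barycenter_ae_eq_baryMap (hcx : ConvexOrderLE η ν) (hk : k ∘ₘ μ = η) (hμ : IsP2 μ)
    (hη : IsP2 η) (hν : IsP2 ν)
    (heq : ∫ x, x * barycenter k x ∂μ = ∫ x, x * baryMap μ ν x ∂μ) :
    barycenter k =ᵐ[μ] baryMap μ ν := by
  have := hμ.isProb
  have hzero := integral_id_mul_baryMap_sub_barycenter hk hμ hη hν
  rw [heq, sub_self] at hzero
  exact (sub_ae_eq_zero _ _).1 (ae_eq_zero_of_integral_id_mul_eq_zero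
    (integrable_baryMap_sub_barycenter hk hμ hη hν)
    (integrable_id_mul_baryMap_sub_barycenter hk hμ hη hν)
    (integral_baryMap_sub_barycenter hcx hk hμ hη hν)
    (setIntegral_Ioi_baryMap_sub_barycenter_nonneg hcx hk hμ hη hν) hzero) |>.symm

end BarycenterComparison

section Optimal

variable {μ η ν : Measure ℝ} {π : Measure (ℝ × ℝ)}

lemma exists_kernel_of_mem_couplings [IsProbabilityMeasure μ] (hπ : π ∈ couplings μ ν) :
    ∃ k : Kernel ℝ ℝ, IsMarkovKernel k ∧ k ∘ₘ μ = ν ∧ π = μ ⊗ₘ k := by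
  have := isProbabilityMeasure_of_mem_couplings hπ
  have hdis : μ ⊗ₘ π.condKernel = π := by
    simpa only [Measure.fst, hπ.1] using π.disintegrate π.condKernel
  exact ⟨π.condKernel, inferInstance, compProd_mem_couplings_iff.1 (hdis.symm ▸ hπ), hdis.symm⟩

lemma integral_mul_comonotoneCoupling (hμ : IsP2 μ) (hν : IsP2 ν) :
    ∫ p, p.1 * p.2 ∂(comonotoneCoupling μ ν) = ∫ x, x * baryMap μ ν x ∂μ := by
  have := hμ.isProb
  have := hν.isProb
  rw [← compProd_quantileKernel, integral_mul_compProd (comp_quantileKernel μ ν) hμ hν,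
    baryMap_eq_barycenter]

lemma integral_mul_le_comonotoneCoupling (hcx : ConvexOrderLE η ν) (hπ : π ∈ couplings μ η)
    (hμ : IsP2 μ) (hη : IsP2 η) (hν : IsP2 ν) :
    ∫ p, p.1 * p.2 ∂π ≤ ∫ p, p.1 * p.2 ∂(comonotoneCoupling μ ν) := by
  have := hμ.isProb
  obtain ⟨k, _, hk, rfl⟩ := exists_kernel_of_mem_couplings hπ
  rw [integral_mul_compProd hk hμ hη, integral_mul_comonotoneCoupling hμ hν]
  exact integral_id_mul_barycenter_le hcx hk hμ hη hν

lemma eq_comonotoneCoupling_of_integral_mul_eq (hπ : π ∈ couplings μ ν) (hμ : IsP2 μ)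
    (hν : IsP2 ν) (heq : ∫ p, p.1 * p.2 ∂π = ∫ p, p.1 * p.2 ∂(comonotoneCoupling μ ν)) :
    π = comonotoneCoupling μ ν := by
  have := hμ.isProb
  have := hν.isProb
  obtain ⟨k, _, hk, rfl⟩ := exists_kernel_of_mem_couplings hπ
  rw [integral_mul_compProd hk hμ hν, integral_mul_comonotoneCoupling hμ hν] at heq
  exact compProd_eq_comonotoneCoupling hk hν.integrable_id
    (barycenter_ae_eq_baryMap (convexOrderLE_refl ν) hk hμ hν hν heq)

lemma W2sq_eq_quadCost_comonotoneCoupling (hμ : IsP2 μ) (hν : IsP2 ν) :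
    W2sq μ ν = quadCost (comonotoneCoupling μ ν) := by
  have := hμ.isProb
  have := hν.isProb
  have hmem := comonotoneCoupling_mem_couplings μ ν
  exact le_antisymm (iInf₂_le _ hmem) (le_iInf₂ fun π hπ =>
    (quadCost_le_quadCost_iff hmem hπ hμ hν).2
      (integral_mul_le_comonotoneCoupling (convexOrderLE_refl ν) hπ hμ hν hν))

lemma toReal_W2sq (hμ : IsP2 μ) (hν : IsP2 ν) :
    (W2sq μ ν).toReal =
      ∫ x, x ^ 2 ∂μ + ∫ y, y ^ 2 ∂ν - 2 * ∫ p, p.1 * p.2 ∂(comonotoneCoupling μ ν) := by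
  have := hμ.isProb
  have := hν.isProb
  rw [W2sq_eq_quadCost_comonotoneCoupling hμ hν,
    toReal_quadCost (comonotoneCoupling_mem_couplings μ ν) hμ hν]

lemma optCouplings_eq_singleton (hμ : IsP2 μ) (hν : IsP2 ν) :
    optCouplings μ ν = {comonotoneCoupling μ ν} := by
  have := hμ.isProb
  have := hν.isProb
  have hmem := comonotoneCoupling_mem_couplings μ ν
  have hW2 := W2sq_eq_quadCost_comonotoneCoupling hμ hν
  refine eq_singleton_iff_unique_mem.2 ⟨⟨isP2_of_mem_couplings hmem hμ hν, hmem, hW2⟩, ?_⟩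
  rintro π ⟨-, hπ, hopt⟩
  refine eq_comonotoneCoupling_of_integral_mul_eq hπ hμ hν (le_antisymm
    (integral_mul_le_comonotoneCoupling (convexOrderLE_refl ν) hπ hμ hν hν)
    ((quadCost_le_quadCost_iff hπ hmem hμ hν).1 ?_))
  exact (hopt.symm.trans hW2).le

end Optimal

section BaryMapGraph

variable {μ η ν : Measure ℝ}

lemma ae_intervalIntegrable_jumpQuantile [IsProbabilityMeasure μ] [IsProbabilityMeasure ν]
    (hν : Integrable (fun y => y) ν) :
    ∀ᵐ x ∂μ, IntervalIntegrable (jumpQuantile μ ν x) volume 0 1 := by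
  filter_upwards [ae_integrable_jumpQuantile hν] with x hx
  exact (intervalIntegrable_iff_integrableOn_Ioo_of_le zero_le_one).2 hx

lemma barySet_eq_singleton (hμ : IsP2 μ) (hν : IsP2 ν) :
    barySet μ ν = {μ.map (baryMap μ ν)} := by
  have := hμ.isProb
  rw [baryMap_eq_barycenter]
  refine eq_singleton_iff_unique_mem.2 ⟨⟨quantileKernel μ ν, inferInstance, ?_, rfl⟩, ?_⟩
  · rw [optCouplings_eq_singleton hμ hν, mem_singleton_iff, compProd_quantileKernel]
  · rintro _ ⟨k, _, hopt, rfl⟩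
    rw [optCouplings_eq_singleton hμ hν, mem_singleton_iff, ← compProd_quantileKernel] at hopt
    refine Measure.map_congr ?_
    filter_upwards [Kernel.ae_eq_of_compProd_eq hopt] with x hx
    rw [hx, barycenter]

lemma map_graph_baryMap_mem_couplings (μ ν : Measure ℝ) :
    μ.map (fun x => (x, baryMap μ ν x)) ∈ couplings μ (μ.map (baryMap μ ν)) :=
  map_prodMk_mem_couplings (MeasurePreserving.id μ) ((measurable_baryMap μ ν).measurePreserving μ)

lemma integral_mul_map_graph_baryMap (hμ : IsP2 μ) (hν : IsP2 ν) :
    ∫ p, p.1 * p.2 ∂(μ.map fun x => (x, baryMap μ ν x)) =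
      ∫ p, p.1 * p.2 ∂(comonotoneCoupling μ ν) := by
  rw [integral_mul_comonotoneCoupling hμ hν, integral_map
    (measurable_id'.prodMk (measurable_baryMap μ ν)).aemeasurable (by fun_prop)]

lemma optCouplings_map_baryMap (hμ : IsP2 μ) (hν : IsP2 ν) :
    optCouplings μ (μ.map (baryMap μ ν)) = {μ.map (fun x => (x, baryMap μ ν x))} := by
  have := hμ.isProb
  have := hν.isProb
  have hm := isP2_map_baryMap hμ hν
  have := hm.isProb
  obtain ⟨S, hS, hmono⟩ := exists_monotoneOn_baryMap (μ := μ) hν.integrable_id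
  rw [optCouplings_eq_singleton hμ hm, singleton_eq_singleton_iff]
  exact IsComonotone.eq (isComonotone_comonotoneCoupling _ _)
    (isComonotone_map_graph (measurable_baryMap μ ν) hmono hS)
    (comonotoneCoupling_mem_couplings _ _) (map_graph_baryMap_mem_couplings μ ν)

lemma toReal_W2sq_eq_iff (hμ : IsP2 μ) (hη : IsP2 η) (hν : IsP2 ν) :
    (W2sq μ ν).toReal = (W2sq μ η).toReal + ∫ y, |y| ^ 2 ∂ν - ∫ z, |z| ^ 2 ∂η ↔
      ∫ p, p.1 * p.2 ∂(comonotoneCoupling μ η) = ∫ p, p.1 * p.2 ∂(comonotoneCoupling μ ν) := by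
  rw [toReal_W2sq hμ hν, toReal_W2sq hμ hη]
  simp only [sq_abs]
  constructor <;> intro h <;> linarith

lemma convexOrderLE_map_baryMap_iff (hcx : ConvexOrderLE η ν) (hμ : IsP2 μ) (hη : IsP2 η)
    (hν : IsP2 ν) :
    ∫ p, p.1 * p.2 ∂(comonotoneCoupling μ η) = ∫ p, p.1 * p.2 ∂(comonotoneCoupling μ ν) ↔
      ConvexOrderLE (μ.map (baryMap μ ν)) η := by
  have := hμ.isProb
  have := hη.isProb
  constructor
  · rw [integral_mul_comonotoneCoupling hμ hη, integral_mul_comonotoneCoupling hμ hν,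
      baryMap_eq_barycenter μ η]
    intro heq
    rw [← Measure.map_congr (barycenter_ae_eq_baryMap hcx (comp_quantileKernel μ η) hμ hη hν heq),
      ← baryMap_eq_barycenter]
    exact convexOrderLE_map_baryMap hη.integrable_id
  · intro hle
    refine le_antisymm (integral_mul_le_comonotoneCoupling hcx
      (comonotoneCoupling_mem_couplings μ η) hμ hη hν) ?_
    rw [← integral_mul_map_graph_baryMap hμ hν]
    exact integral_mul_le_comonotoneCoupling hle (map_graph_baryMap_mem_couplings μ ν) hμ
      (isP2_map_baryMap hμ hν) hη

lemma interSet_eq (hμ : IsP2 μ) (hν : IsP2 ν) :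
    interSet μ ν =
      {η | IsP2 η ∧ ConvexOrderLE (μ.map (baryMap μ ν)) η ∧ ConvexOrderLE η ν} := by
  ext η
  simp only [interSet, mem_ofPred_eq]
  refine and_congr_right fun hη => ?_
  rw [and_comm]
  refine and_congr_left fun hcx => ?_
  rw [toReal_W2sq_eq_iff hμ hη hν, convexOrderLE_map_baryMap_iff hcx hμ hη hν]

end BaryMapGraph

section Martingale

lemma barycenter_ae_eq_id {α : Type*} [MeasurableSpace α] {μ : Measure α} [IsFiniteMeasure μ]
    {ν : Measure ℝ} {k : Kernel α ℝ} [IsMarkovKernel k] {k' : Kernel ℝ ℝ} [IsMarkovKernel k']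
    (hk : k ∘ₘ μ = ν) (hν : Integrable (fun y => y) ν)
    (hmap : (μ ⊗ₘ k).map (Prod.map (barycenter k) id) = μ.map (barycenter k) ⊗ₘ k') :
    barycenter k' =ᵐ[μ.map (barycenter k)] id := by
  have hmeas := measurable_barycenter k
  have hk' : k' ∘ₘ μ.map (barycenter k) = ν := by
    rw [← Measure.snd_compProd, ← hmap, Measure.snd,
      Measure.map_map measurable_snd (hmeas.prodMap measurable_id), ← hk, ← Measure.snd_compProd]
    rfl
  refine (integrable_barycenter hk' hν).ae_eq_of_forall_setIntegral_eq _ _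
    ((integrable_map_measure measurable_id.aestronglyMeasurable hmeas.aemeasurable).2
      (integrable_barycenter hk hν))
    fun B hB _ => ?_
  calc ∫ z in B, barycenter k' z ∂(μ.map (barycenter k))
      = ∫ p in Prod.fst ⁻¹' B, p.2 ∂(μ ⊗ₘ k).map (Prod.map (barycenter k) id) := by
        rw [setIntegral_barycenter hk' hν hB, hmap]
    _ = ∫ p in Prod.fst ⁻¹' (barycenter k ⁻¹' B), p.2 ∂(μ ⊗ₘ k) :=
        setIntegral_map (measurable_fst hB) (by fun_prop)
          (hmeas.prodMap measurable_id).aemeasurable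
    _ = ∫ x in barycenter k ⁻¹' B, barycenter k x ∂μ :=
        (setIntegral_barycenter hk hν (hmeas hB)).symm
    _ = ∫ z in B, id z ∂(μ.map (barycenter k)) :=
        (setIntegral_map hB measurable_id.aestronglyMeasurable hmeas.aemeasurable).symm

lemma exists_isMartingaleKernel_ae_eq {η : Measure ℝ} {k : Kernel ℝ ℝ} [IsMarkovKernel k]
    (hint : ∀ᵐ x ∂η, Integrable (fun y => y) (k x)) (hbary : barycenter k =ᵐ[η] id) :
    ∃ k', IsMartingaleKernel k' ∧ k' =ᵐ[η] k := by
  classical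
  have hmeas : MeasurableSet {x | Integrable (fun y => y) (k x) ∧ barycenter k x = x} :=
    (measurableSet_kernel_integrable measurable_snd.stronglyMeasurable).inter
      (measurableSet_eq_fun (measurable_barycenter k) measurable_id)
  refine ⟨Kernel.piecewise hmeas k Kernel.id, ⟨inferInstance, fun x => ?_⟩, ?_⟩
  · rw [Kernel.piecewise_apply]
    split_ifs with hx
    · exact hx
    · rw [Kernel.id_apply]
      exact ⟨integrable_dirac (by simp), integral_dirac _ _⟩
  · filter_upwards [hint, hbary] with x hx hxb
    rw [Kernel.piecewise_apply, if_pos ⟨hx, hxb⟩]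

variable {μ η ν : Measure ℝ} [IsProbabilityMeasure μ] [IsProbabilityMeasure η]
  [IsProbabilityMeasure ν]

lemma martingaleCouplings_eq_singleton (hν : Integrable (fun y => y) ν)
    (hbary : baryMap η ν =ᵐ[η] id) : martingaleCouplings η ν = {comonotoneCoupling η ν} := by
  refine eq_singleton_iff_unique_mem.2 ⟨⟨comonotoneCoupling_mem_couplings η ν, ?_⟩, ?_⟩
  · obtain ⟨k, hk, hae⟩ := exists_isMartingaleKernel_ae_eq
      (Measure.ae_integrable_of_integrable_comp ((comp_quantileKernel η ν).symm ▸ hν))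
      (baryMap_eq_barycenter η ν ▸ hbary)
    have := hk.1
    exact ⟨k, hk, by rw [← compProd_quantileKernel, Measure.compProd_congr hae]⟩
  · rintro _ ⟨hmem, k, ⟨_, hk⟩, rfl⟩
    have hid : barycenter k = id := funext fun x => (hk x).2
    exact compProd_eq_comonotoneCoupling (compProd_mem_couplings_iff.1 hmem) hν
      (hid ▸ hbary.symm)

lemma map_prodMap_baryMap_comonotoneCoupling (hν : Integrable (fun y => y) ν) :
    (comonotoneCoupling μ ν).map (Prod.map (baryMap μ ν) id) =
      comonotoneCoupling (μ.map (baryMap μ ν)) ν := by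
  have hT := measurable_baryMap μ ν
  have := Measure.isProbabilityMeasure_map hT.aemeasurable (μ := μ)
  have hmem := comonotoneCoupling_mem_couplings μ ν
  have := isProbabilityMeasure_of_mem_couplings hmem
  have hfst := measurePreserving_fst_of_mem_couplings hmem
  have hsnd := measurePreserving_snd_of_mem_couplings hmem
  obtain ⟨S, hS, hmono⟩ := exists_monotoneOn_baryMap (μ := μ) hν
  exact IsComonotone.eq
    ((isComonotone_comonotoneCoupling μ ν).map_prodMap hT hmono (hfst.quasiMeasurePreserving.ae hS))
    (isComonotone_comonotoneCoupling _ _)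
    (map_prodMk_mem_couplings ((hT.measurePreserving μ).comp hfst) hsnd)
    (comonotoneCoupling_mem_couplings _ _)

lemma baryMap_map_baryMap_ae_eq_id (hν : Integrable (fun y => y) ν) :
    baryMap (μ.map (baryMap μ ν)) ν =ᵐ[μ.map (baryMap μ ν)] id := by
  have := Measure.isProbabilityMeasure_map (measurable_baryMap μ ν).aemeasurable (μ := μ)
  have hmap := map_prodMap_baryMap_comonotoneCoupling (μ := μ) hν
  rw [← compProd_quantileKernel μ, ← compProd_quantileKernel (μ.map _),
    baryMap_eq_barycenter μ ν] at hmap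
  rw [baryMap_eq_barycenter (μ.map _), baryMap_eq_barycenter μ ν]
  exact barycenter_ae_eq_id (comp_quantileKernel μ ν) hν hmap

end Martingale

theorem proposition3 (μ ν : Measure ℝ) (hμ : IsP2 μ) (hν : IsP2 ν) :
    AEMeasurable (baryMap μ ν) μ ∧
    (∀ᵐ x ∂μ, IntervalIntegrable (jumpQuantile μ ν x) volume 0 1) ∧
    barySet μ ν = {μ.map (baryMap μ ν)} ∧
    interSet μ ν =
      {η | IsP2 η ∧ ConvexOrderLE (μ.map (baryMap μ ν)) η ∧ ConvexOrderLE η ν} ∧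
    optCouplings μ (μ.map (baryMap μ ν)) = {μ.map (fun x => (x, baryMap μ ν x))} ∧
    ∃ π ∈ optCouplings (μ.map (baryMap μ ν)) ν,
      martingaleCouplings (μ.map (baryMap μ ν)) ν = {π} := by
  have := hμ.isProb
  have := hν.isProb
  have hm := isP2_map_baryMap hμ hν
  have := hm.isProb
  refine ⟨(measurable_baryMap μ ν).aemeasurable,
    ae_intervalIntegrable_jumpQuantile hν.integrable_id, barySet_eq_singleton hμ hν,
    interSet_eq hμ hν, optCouplings_map_baryMap hμ hν, comonotoneCoupling (μ.map (baryMap μ ν)) ν,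
    ?_, martingaleCouplings_eq_singleton hν.integrable_id
      (baryMap_map_baryMap_ae_eq_id hν.integrable_id)⟩
  rw [optCouplings_eq_singleton hm hν]
  exact mem_singleton _
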